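/- Let $X$ be a set, let $(X\cup X^{-1})^*$ be the set of all words (not necessarily freely reduced) in the letters $x^{\pm1}$, $x\in X$, and let $\mathcal R\subseteq (X\cup X^{-1})^*\times (X\cup X^{-1})^*$ be a set of relations, so that $\mathcal P=\langle X:\mathcal R\rangle$ is a group presentation. Let $F(X)$ be the free group on $X$; words are read as elements of $F(X)$. A crossed $F(X)$-module is a group homomorphism $\partial:T\to F(X)$ together with a right action $(t,g)\mapsto t^g$ of $F(X)$ on $T$ by automorphisms such that $\partial(t^g)=g^{-1}\,\partial(t)\,g$ and $t^{\partial(s)}=s^{-1}ts$ for all $s,t\in T$, $g\in F(X)$; an isomorphism of crossed $F(X)$-modules is an $F(X)$-equivariant group isomorphism commuting with the maps to $F(X)$. The reduced Squier complex $\mathrm{Sq}^\rho(\mathcal P)$ is the $2$-complex with vertex set $F(X)$, with an edge $(p,l,r,q)$ from $plq$ to $prq$ for all $p,q\in F(X)$ and $(l,r)\in\mathcal R$, and with $2$-cells making the edge paths $$(p,l,r,qp'l'q')\,(prqp',l',r',q')\quad\text{and}\quad (plqp',l',r',q')\,(p,l,r,qp'r'q')$$ homotopic, for all $p,q,p',q'\in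 F(X)$ and $(l,r),(l',r')\in\mathcal R$. Let $\pi$ be its fundamental groupoid on the vertex set $F(X)$; write $\alpha\mathbf d$ and $\alpha\mathbf r$ for the start and the end of $\alpha\in\pi$, and $\circ$ for composition in order of traversal. The rules $x\rhd(p,l,r,q)=(xp,l,r,q)$ and $(p,l,r,q)\lhd x=(p,l,r,qx)$ induce left and right actions of $F(X)$ on $\pi$. Let $\operatorname{star}_1(\mathrm{Sq}^\rho(\mathcal P))=\{\alpha\in\pi:\alpha\mathbf d=1\}$. It is a group under $\alpha*\beta=(\alpha\lhd\beta\mathbf d)\circ(\alpha\mathbf r\rhd\beta)$, and with the action $\alpha^g=g^{-1}\rhd\alpha\lhd g$ the end-point map $\mathbf r:\operatorname{star}_1(\mathrm{Sq}^\rho(\mathcal P))\to F(X)$ is a crossed $F(X)$-module. For $(l,r)\in\mathcal R$ and $u\in F(X)$ let $\lambda_{l,r,u}\in\operatorname{star}_1(\mathrm{Sq}^\rho(\mathcal P))$ be the homotopy class of the edge $(u^{-1}l^{-1},l,r,u)$. Let $\hat\rho:\mathcal R\to F(X)$, $\hat\rho(l,r)=l^{-1}r$, and let $C$ be the quotient of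 the free group on $\mathcal R\times F(X)$ by the normal closure of the Peiffer elements $(a,u)^{-1}(b,v)^{-1}(a,u)(b,\,vu^{-1}\hat\rho(a)u)$, for $a,b\in\mathcal R$ and $u,v\in F(X)$, with $\partial(a,u)=u^{-1}\hat\rho(a)u$ and the action $(a,u)^g=(a,ug)$; for $a=(l,r)$ write $(l,r,u)$ for the element $(a,u)$ of $C$. **Theorem.** $C\xrightarrow{\partial}F(X)$ is the free crossed $F(X)$-module on $\hat\rho$, with basis $(l,r)\mapsto(l,r,1)$: we have $\partial(l,r,1)=\hat\rho(l,r)$, and for every crossed $F(X)$-module $(T',\partial')$ and function $\sigma:\mathcal R\to T'$ with $\partial'\sigma=\hat\rho$ there is a unique morphism of crossed $F(X)$-modules $C\to T'$ sending $(l,r,1)$ to $\sigma(l,r)$ for every $(l,r)\in\mathcal R$. Moreover, there is an isomorphism of crossed $F(X)$-modules from $\operatorname{star}_1(\mathrm{Sq}^\rho(\mathcal P))\xrightarrow{\mathbf r}F(X)$ to $C\xrightarrow{\partial}F(X)$ that sends $\lambda_{l,r,u}$ to $(l,r,u)$ for all $(l,r)\in\mathcal R$ and $u\in F(X)$. -/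

import Mathlib

universe u v w

namespace Squier

open CategoryTheory

/-! ## Crossed modules -/

/-- A crossed `Γ`-module: a group homomorphism `bd : T → Γ` with a right action
`(t, g) ↦ t ^ g` of `Γ` on `T` by automorphisms, satisfying
`bd (t ^ g) = g⁻¹ (bd t) g` and `t ^ (bd s) = s⁻¹ t s`. -/
structure CrossedModule (Γ : Type u) [Group Γ] where
  carrier : Type v
  [group : Group carrier]
  bd : carrier →* Γ
  act : carrier → Γ → carrier
  act_one : ∀ t, act t 1 = t
  act_mul : ∀ t g h, act t (g * h) = act (act t g) h
  mul_act : ∀ t s g, act (t * s) g = act t g * act s g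
  bd_act : ∀ t g, bd (act t g) = g⁻¹ * bd t * g
  peiffer : ∀ t s, act t (bd s) = s⁻¹ * t * s

namespace CrossedModule

attribute [instance] CrossedModule.group

variable {Γ : Type u} [Group Γ]

/-- Morphisms of crossed `Γ`-modules: equivariant homomorphisms over `Γ`. -/
structure Hom (T : CrossedModule.{u, v} Γ) (T' : CrossedModule.{u, w} Γ) where
  toHom : T.carrier →* T'.carrier
  map_act : ∀ t g, toHom (T.act t g) = T'.act (toHom t) g
  bd_map : ∀ t, T'.bd (toHom t) = T.bd t

/-- Isomorphisms of crossed `Γ`-modules: equivariant group isomorphisms over `Γ`. -/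
structure Iso (T : CrossedModule.{u, v} Γ) (T' : CrossedModule.{u, w} Γ) where
  toEquiv : T.carrier ≃* T'.carrier
  map_act : ∀ t g, toEquiv (T.act t g) = T'.act (toEquiv t) g
  bd_map : ∀ t, T'.bd (toEquiv t) = T.bd t

/-- `T` is a free crossed `Γ`-module with basis `ρ : R → T`
(tested against crossed modules in an arbitrary universe `w`). -/
def IsFree (T : CrossedModule.{u, v} Γ) {R : Type*} (ρ : R → T.carrier) : Prop :=
  ∀ (T' : CrossedModule.{u, w} Γ) (σ : R → T'.carrier),
    (∀ r, T'.bd (σ r) = T.bd (ρ r)) → ∃! φ : Hom T T', ∀ r, φ.toHom (ρ r) = σ r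

end CrossedModule

/-! ## Whitehead's construction of the free crossed module on `ω : R → Γ` -/

section Free

variable {Γ : Type u} [Group Γ] {R : Type v} (ω : R → Γ)

/-- The Peiffer elements `(r,u)⁻¹ (s,v)⁻¹ (r,u) (s, v u⁻¹ (ω r) u)` in the free group
on `R × Γ`. -/
def peifferElements : Set (FreeGroup (R × Γ)) :=
  {x | ∃ (r s : R) (u v : Γ), x = (FreeGroup.of (r, u))⁻¹ * (FreeGroup.of (s, v))⁻¹ *
    FreeGroup.of (r, u) * FreeGroup.of (s, v * u⁻¹ * ω r * u)}

/-- The free group on `R × Γ` modulo the normal closure of the Peiffer elements. -/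
abbrev FreeCM : Type (max u v) := PresentedGroup (peifferElements ω)

/-- The image of the generator `(r, u)`. -/
def FreeCM.gen (r : R) (u : Γ) : FreeCM ω := PresentedGroup.of (r, u)

theorem FreeCM.rel (r s : R) (u v : Γ) :
    (FreeCM.gen ω r u)⁻¹ * (FreeCM.gen ω s v)⁻¹ * FreeCM.gen ω r u *
      FreeCM.gen ω s (v * u⁻¹ * ω r * u) = 1 :=
  PresentedGroup.one_of_mem (rels := peifferElements ω) ⟨r, s, u, v, rfl⟩

/-- The boundary `(r, u) ↦ u⁻¹ (ω r) u`. -/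
def FreeCM.bd : FreeCM ω →* Γ :=
  PresentedGroup.toGroup (f := fun x : R × Γ => x.2⁻¹ * ω x.1 * x.2) (by
    rintro _ ⟨r, s, u, v, rfl⟩
    simp
    group)

/-- The action of `g`, determined by `(r, u) ↦ (r, u g)`. -/
def FreeCM.actHom (g : Γ) : FreeCM ω →* FreeCM ω :=
  PresentedGroup.toGroup (f := fun x : R × Γ => FreeCM.gen ω x.1 (x.2 * g)) (by
    rintro _ ⟨r, s, u, v, rfl⟩
    have h := FreeCM.rel ω r s (u * g) (v * g)
    have e : v * g * (u * g)⁻¹ * ω r * (u * g) = v * u⁻¹ * ω r * u * g := by group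
    rw [e] at h
    simpa using h)

@[simp] theorem FreeCM.bd_gen (r : R) (u : Γ) :
    FreeCM.bd ω (FreeCM.gen ω r u) = u⁻¹ * ω r * u :=
  PresentedGroup.toGroup.of _

@[simp] theorem FreeCM.actHom_gen (g : Γ) (r : R) (u : Γ) :
    FreeCM.actHom ω g (FreeCM.gen ω r u) = FreeCM.gen ω r (u * g) :=
  PresentedGroup.toGroup.of _

theorem FreeCM.hom_ext {G : Type*} [Group G] {f g : FreeCM ω →* G}
    (h : ∀ r u, f (FreeCM.gen ω r u) = g (FreeCM.gen ω r u)) : f = g :=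
  PresentedGroup.ext (fun x => h x.1 x.2)

theorem FreeCM.actHom_mul (g h : Γ) :
    FreeCM.actHom ω (g * h) = (FreeCM.actHom ω h).comp (FreeCM.actHom ω g) :=
  FreeCM.hom_ext ω (fun r u => by simp [mul_assoc])

theorem FreeCM.actHom_one : FreeCM.actHom ω 1 = MonoidHom.id _ :=
  FreeCM.hom_ext ω (fun r u => by simp)

theorem FreeCM.peiffer (t s : FreeCM ω) : FreeCM.actHom ω (FreeCM.bd ω s) t = s⁻¹ * t * s := by
  let H : Subgroup (FreeCM ω) :=
    { carrier := {s | ∀ t, FreeCM.actHom ω (FreeCM.bd ω s) t = s⁻¹ * t * s}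
      one_mem' := fun t => by simp [FreeCM.actHom_one]
      mul_mem' := fun {a b} ha hb t => by
        change ∀ t, _ = _ at ha hb
        rw [map_mul, FreeCM.actHom_mul, MonoidHom.comp_apply, ha, hb]
        group
      inv_mem' := fun {a} ha t => by
        change ∀ t, _ = _ at ha
        have h1 := ha (FreeCM.actHom ω (FreeCM.bd ω a⁻¹) t)
        rw [← MonoidHom.comp_apply, ← FreeCM.actHom_mul, ← map_mul, inv_mul_cancel, map_one,
          FreeCM.actHom_one, MonoidHom.id_apply] at h1
        calc FreeCM.actHom ω (FreeCM.bd ω a⁻¹) t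
            = a * (a⁻¹ * FreeCM.actHom ω (FreeCM.bd ω a⁻¹) t * a) * a⁻¹ := by group
          _ = a * t * a⁻¹ := by rw [← h1]
          _ = a⁻¹⁻¹ * t * a⁻¹ := by rw [inv_inv] }
  refine PresentedGroup.generated_by _ H ?_ s t
  rintro ⟨r, u⟩ t
  change FreeCM.actHom ω (FreeCM.bd ω (FreeCM.gen ω r u)) t =
    (FreeCM.gen ω r u)⁻¹ * t * FreeCM.gen ω r u
  have key : FreeCM.actHom ω (FreeCM.bd ω (FreeCM.gen ω r u)) =
      (MulAut.conj (FreeCM.gen ω r u)⁻¹).toMonoidHom := by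
    refine FreeCM.hom_ext ω (fun s v => ?_)
    have h := FreeCM.rel ω r s u v
    have h2 := inv_eq_of_mul_eq_one_right h
    simp only [FreeCM.actHom_gen, FreeCM.bd_gen, MulEquiv.toMonoidHom_eq_coe, MonoidHom.coe_coe,
      MulAut.conj_apply, inv_inv, ← mul_assoc]
    rw [← h2]
    group
  rw [key]
  simp

/-- The crossed `Γ`-module `(r, u) ↦ u⁻¹ (ω r) u`. -/
def freeCrossedModule : CrossedModule.{u, max u v} Γ where
  carrier := FreeCM ω
  bd := FreeCM.bd ω
  act t g := FreeCM.actHom ω g t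
  act_one t := by rw [FreeCM.actHom_one]; rfl
  act_mul t g h := by rw [FreeCM.actHom_mul]; rfl
  mul_act t s g := map_mul _ t s
  bd_act t g := by
    have : (FreeCM.bd ω).comp (FreeCM.actHom ω g) =
        (MulAut.conj g⁻¹).toMonoidHom.comp (FreeCM.bd ω) :=
      FreeCM.hom_ext ω (fun r u => by simp [mul_assoc])
    simpa using DFunLike.congr_fun this t
  peiffer := FreeCM.peiffer ω

end Free

/-! ## Regular groupoids -/

/-- A regular groupoid: a groupoid whose vertex set `V` is a group, with left and right actions
of `V` on arrows, compatible with sources, targets, composition and identities; the action laws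
for the two actions compare arrows between propositionally equal vertices. -/
class RegularGroupoid (V : Type u) [Group V] extends Groupoid.{v} V where
  wl : ∀ (x : V) {a b : V}, (a ⟶ b) → (x * a ⟶ x * b)
  wr : ∀ {a b : V}, (a ⟶ b) → ∀ x : V, (a * x ⟶ b * x)
  wl_id : ∀ x a : V, wl x (𝟙 a) = 𝟙 (x * a)
  wr_id : ∀ a x : V, wr (𝟙 a) x = 𝟙 (a * x)
  wl_comp : ∀ (x : V) {a b c : V} (f : a ⟶ b) (g : b ⟶ c), wl x (f ≫ g) = wl x f ≫ wl x g
  wr_comp : ∀ {a b c : V} (f : a ⟶ b) (g : b ⟶ c) (x : V), wr (f ≫ g) x = wr f x ≫ wr g x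
  wl_mul : ∀ (x y : V) {a b : V} (f : a ⟶ b), wl (x * y) f ≍ wl x (wl y f)
  wr_mul : ∀ {a b : V} (f : a ⟶ b) (x y : V), wr f (x * y) ≍ wr (wr f x) y
  wl_wr : ∀ (x : V) {a b : V} (f : a ⟶ b) (y : V), wr (wl x f) y ≍ wl x (wr f y)
  wl_one : ∀ {a b : V} (f : a ⟶ b), wl 1 f ≍ f
  wr_one : ∀ {a b : V} (f : a ⟶ b), wr f 1 ≍ f

/-- The elements of a groupoid with vertex set `V`: all of its arrows, with domain `d` and
range `r`. -/
@[ext] structure Elt (V : Type u) [Groupoid.{v} V] where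
  d : V
  r : V
  hom : d ⟶ r

theorem comp_heq' {V : Type u} [Groupoid.{v} V] {a b c a' b' c' : V} {f : a ⟶ b} {g : b ⟶ c}
    {f' : a' ⟶ b'} {g' : b' ⟶ c'} (ha : a = a') (hb : b = b') (hc : c = c') (hf : f ≍ f')
    (hg : g ≍ g') : f ≫ g ≍ f' ≫ g' := by
  subst ha hb hc
  cases hf
  cases hg
  rfl

theorem inv_heq' {V : Type u} [Groupoid.{v} V] {a b a' b' : V} {f : a ⟶ b}
    {f' : a' ⟶ b'} (ha : a = a') (hb : b = b') (hf : f ≍ f') :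
    Groupoid.inv f ≍ Groupoid.inv f' := by
  subst ha hb
  cases hf
  rfl

section Regular

variable {V : Type u} [Group V] [RegularGroupoid.{u, v} V]

open RegularGroupoid

theorem wl_heq {x x' a b a' b' : V} {f : a ⟶ b} {f' : a' ⟶ b'} (hx : x = x') (ha : a = a')
    (hb : b = b') (hf : f ≍ f') : wl x f ≍ wl x' f' := by
  subst hx ha hb
  cases hf
  rfl

theorem wr_heq {x x' a b a' b' : V} {f : a ⟶ b} {f' : a' ⟶ b'} (hx : x = x') (ha : a = a')
    (hb : b = b') (hf : f ≍ f') : wr f x ≍ wr f' x' := by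
  subst hx ha hb
  cases hf
  rfl

theorem wl_inv (x : V) {a b : V} (f : a ⟶ b) :
    wl x (Groupoid.inv f) = Groupoid.inv (wl x f) := by
  rw [Groupoid.inv_eq_inv (wl x f)]
  refine IsIso.eq_inv_of_hom_inv_id ?_
  rw [← wl_comp, Groupoid.comp_inv, wl_id]

theorem wr_inv {a b : V} (f : a ⟶ b) (x : V) :
    wr (Groupoid.inv f) x = Groupoid.inv (wr f x) := by
  rw [Groupoid.inv_eq_inv (wr f x)]
  refine IsIso.eq_inv_of_hom_inv_id ?_
  rw [← wr_comp, Groupoid.comp_inv, wr_id]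

/-- The left action `x ▷ α`. -/
def Elt.lact (x : V) (α : Elt V) : Elt V := ⟨x * α.d, x * α.r, wl x α.hom⟩

/-- The right action `α ◁ x`. -/
def Elt.ract (α : Elt V) (x : V) : Elt V := ⟨α.d * x, α.r * x, wr α.hom x⟩

/-- `α * β = (α ◁ βd) ∘ (αr ▷ β)`, composition being written in the order of traversal. -/
def Elt.star (α β : Elt V) : Elt V :=
  ⟨α.d * β.d, α.r * β.r, wr α.hom β.d ≫ wl α.r β.hom⟩

/-- `α ⊛ β = (αd ▷ β) ∘ (α ◁ βr)`. -/
def Elt.circledStar (α β : Elt V) : Elt V :=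
  ⟨α.d * β.d, α.r * β.r, wl α.d β.hom ≫ wr α.hom β.r⟩

/-- The group structure `*` on the elements of a regular groupoid. -/
instance Elt.instGroup : Group (Elt V) where
  mul := Elt.star
  one := ⟨1, 1, 𝟙 1⟩
  inv α := ⟨α.r⁻¹ * α.r * α.d⁻¹, α.r⁻¹ * α.d * α.d⁻¹,
    wr (wl α.r⁻¹ (Groupoid.inv α.hom)) α.d⁻¹⟩
  mul_assoc α β γ := by
    refine Elt.ext (mul_assoc _ _ _) (mul_assoc _ _ _) ?_
    change wr (wr α.hom β.d ≫ wl α.r β.hom) γ.d ≫ wl (α.r * β.r) γ.hom ≍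
      wr α.hom (β.d * γ.d) ≫ wl α.r (wr β.hom γ.d ≫ wl β.r γ.hom)
    rw [wr_comp, wl_comp, Category.assoc]
    refine comp_heq' (mul_assoc _ _ _) (mul_assoc _ _ _) (mul_assoc _ _ _) (wr_mul _ _ _).symm ?_
    exact comp_heq' (mul_assoc _ _ _) (mul_assoc _ _ _) (mul_assoc _ _ _) (wl_wr _ _ _)
      (wl_mul _ _ _)
  one_mul α := by
    refine Elt.ext (one_mul _) (one_mul _) ?_
    change wr (𝟙 (1 : V)) α.d ≫ wl 1 α.hom ≍ α.hom
    rw [wr_id, Category.id_comp]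
    exact wl_one _
  mul_one α := by
    refine Elt.ext (mul_one _) (mul_one _) ?_
    change wr α.hom 1 ≫ wl α.r (𝟙 (1 : V)) ≍ α.hom
    rw [wl_id, Category.comp_id]
    exact wr_one _
  inv_mul_cancel α := by
    refine Elt.ext (by change _ * _ * _ * α.d = 1; group) (by change _ * _ * _ * α.r = 1; group) ?_
    change wr (wr (wl α.r⁻¹ (Groupoid.inv α.hom)) α.d⁻¹) α.d ≫ wl (α.r⁻¹ * α.d * α.d⁻¹) α.hom ≍
      𝟙 (1 : V)
    have h1 : wr (wr (wl α.r⁻¹ (Groupoid.inv α.hom)) α.d⁻¹) α.d ≍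
        wl α.r⁻¹ (Groupoid.inv α.hom) := by
      refine (wr_mul _ _ _).symm.trans ?_
      refine (wr_heq (inv_mul_cancel α.d) rfl rfl HEq.rfl).trans (wr_one _)
    have h2 : wl (α.r⁻¹ * α.d * α.d⁻¹) α.hom ≍ wl α.r⁻¹ α.hom :=
      wl_heq (by group) rfl rfl HEq.rfl
    refine (comp_heq' (by group) (by group) (by group) h1 h2).trans ?_
    rw [← wl_comp, Groupoid.inv_comp, wl_id]
    rw [inv_mul_cancel]

/-- The range map, a homomorphism for `*`. -/
def rHom (V : Type u) [Group V] [RegularGroupoid.{u, v} V] : Elt V →* V where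
  toFun := Elt.r
  map_one' := rfl
  map_mul' _ _ := rfl

/-- The subgroup `star₁` of all elements with domain `1`. -/
def starOne (V : Type u) [Group V] [RegularGroupoid.{u, v} V] : Subgroup (Elt V) where
  carrier := {α | α.d = 1}
  one_mem' := rfl
  mul_mem' {α β} hα hβ := by
    change α.d * β.d = 1
    change α.d = 1 at hα
    change β.d = 1 at hβ
    rw [hα, hβ, one_mul]
  inv_mem' {α} hα := by
    change α.r⁻¹ * α.r * α.d⁻¹ = 1
    change α.d = 1 at hα
    rw [hα]
    group

variable (V) in
/-- A regular groupoid is monoidal if `*` and `⊛` coincide. -/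
def IsMonoidal : Prop := ∀ α β : Elt V, Elt.star α β = Elt.circledStar α β

/-- `α ^ q = q⁻¹ ▷ α ◁ q`. -/
def Elt.conjAct (α : Elt V) (q : V) : Elt V := (α.lact q⁻¹).ract q

theorem Elt.conjAct_eq (α : Elt V) (q : V) :
    α.conjAct q = (⟨q, q, 𝟙 q⟩ : Elt V)⁻¹ * α * ⟨q, q, 𝟙 q⟩ := by
  have hinv : (⟨q, q, 𝟙 q⟩ : Elt V)⁻¹ = ⟨q⁻¹, q⁻¹, 𝟙 q⁻¹⟩ := by
    rw [inv_eq_iff_mul_eq_one]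
    refine Elt.ext (mul_inv_cancel q) (mul_inv_cancel q) ?_
    change wr (𝟙 q) q⁻¹ ≫ wl q (𝟙 q⁻¹) ≍ 𝟙 (1 : V)
    rw [wl_id, wr_id, Category.comp_id, mul_inv_cancel]
  rw [hinv]
  refine Elt.ext rfl rfl ?_
  change wr (wl q⁻¹ α.hom) q ≍ wr (wr (𝟙 q⁻¹) α.d ≫ wl q⁻¹ α.hom) q ≫ wl (q⁻¹ * α.r) (𝟙 q)
  rw [wl_id, wr_id, Category.id_comp, Category.comp_id]

/-- The crossed module `r : star₁ → V` of a monoidal regular groupoid, with the group operation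
`*` on `star₁` and the action `α ^ q = q⁻¹ ▷ α ◁ q`. -/
def starCrossedModule (h : IsMonoidal V) : CrossedModule.{u, max u v} V where
  carrier := starOne V
  bd := (rHom V).comp (starOne V).subtype
  act α q := ⟨α.1.conjAct q, by
    have hα : α.1.d = 1 := α.2
    change q⁻¹ * α.1.d * q = 1
    rw [hα]
    group⟩
  act_one α := Subtype.ext (by
    have : (⟨1, 1, 𝟙 1⟩ : Elt V) = 1 := rfl
    simp [Elt.conjAct_eq, this])
  act_mul α g k := Subtype.ext (by
    have : (⟨g * k, g * k, 𝟙 (g * k)⟩ : Elt V) = ⟨g, g, 𝟙 g⟩ * ⟨k, k, 𝟙 k⟩ := by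
      refine Elt.ext rfl rfl ?_
      change 𝟙 (g * k) ≍ wr (𝟙 g) k ≫ wl g (𝟙 k)
      rw [wl_id, wr_id, Category.comp_id]
    simp only [Elt.conjAct_eq, this]
    group)
  mul_act α β g := Subtype.ext (by
    simp only [Elt.conjAct_eq, Subgroup.coe_mul]
    group)
  bd_act α g := rfl
  peiffer α β := by
    refine Subtype.ext ?_
    change Elt.conjAct α.1 β.1.r = β.1⁻¹ * α.1 * β.1
    rw [mul_assoc, eq_inv_mul_iff_mul_eq]
    have hα : α.1.d = 1 := α.2
    have hβ : β.1.d = 1 := β.2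
    have e : α.1 * β.1 = Elt.circledStar α.1 β.1 := h α.1 β.1
    change β.1 * Elt.conjAct α.1 β.1.r = α.1 * β.1
    rw [e]
    refine Elt.ext ?_ ?_ ?_
    · change β.1.d * (β.1.r⁻¹ * α.1.d * β.1.r) = α.1.d * β.1.d
      rw [hα, hβ]
      group
    · change β.1.r * (β.1.r⁻¹ * α.1.r * β.1.r) = α.1.r * β.1.r
      group
    · change wr β.1.hom (β.1.r⁻¹ * α.1.d * β.1.r) ≫ wl β.1.r (wr (wl β.1.r⁻¹ α.1.hom) β.1.r) ≍
        wl α.1.d β.1.hom ≫ wr α.1.hom β.1.r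
      refine comp_heq' (by rw [hα, hβ]; group) (by rw [hα]; group) (by group) ?_ ?_
      · refine (wr_heq (x' := 1) (by rw [hα]; group) rfl rfl HEq.rfl).trans ?_
        refine (wr_one _).trans ?_
        exact ((wl_heq hα rfl rfl HEq.rfl).trans (wl_one _)).symm
      · refine (wl_wr _ _ _).symm.trans ?_
        refine wr_heq rfl (by group) (by group) ?_
        refine (wl_mul _ _ _).symm.trans ?_
        exact (wl_heq (mul_inv_cancel _) rfl rfl HEq.rfl).trans (wl_one _)

end Regular

/-! ## The reduced Squier complex of a group presentation -/

section Complex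

/-- Words over `A = X ∪ X⁻¹`; the letter `(x, true)` is `x` and `(x, false)` is `x⁻¹`. -/
abbrev Word (X : Type u) : Type u := List (X × Bool)

variable {X : Type u} (𝓡 : Set (Word X × Word X))

variable {𝓡} in
/-- The left-hand side of a relation, as an element of the free group. -/
def lhs (s : 𝓡) : FreeGroup X := FreeGroup.mk s.1.1

variable {𝓡} in
/-- The right-hand side of a relation, as an element of the free group. -/
def rhs (s : 𝓡) : FreeGroup X := FreeGroup.mk s.1.2

variable {𝓡} in
/-- The function `(l, r) ↦ l⁻¹ r` from the relations to the free group. -/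
def rhoHat (s : 𝓡) : FreeGroup X := (lhs s)⁻¹ * rhs s

/-- Edges `(p, l, r, q)` with `p, q ∈ F(X)` and `(l, r)` a relation. -/
@[ext] structure Edge where
  p : FreeGroup X
  rel : 𝓡
  q : FreeGroup X

variable {𝓡} in
/-- The start `p l q`. -/
def Edge.src (e : Edge 𝓡) : FreeGroup X := e.p * lhs e.rel * e.q

variable {𝓡} in
/-- The end `p r q`. -/
def Edge.tgt (e : Edge 𝓡) : FreeGroup X := e.p * rhs e.rel * e.q

/-- The vertex set `F(X)` of the 1-skeleton of the reduced Squier complex. -/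
def Skeleton (_ : Set (Word X × Word X)) : Type u := FreeGroup X

/-- The 1-skeleton of the reduced Squier complex. -/
instance : Quiver.{u} (Skeleton 𝓡) where
  Hom a b := {e : Edge 𝓡 // e.src = a ∧ e.tgt = b}

/-- The 2-cells: the edge paths `(p, l, r, q p' l' q') (p r q p', l', r', q')` and
`(p l q p', l', r', q') (p, l, r, q p' r' q')` are declared homotopic. -/
inductive Cell : HomRel (Quiver.FreeGroupoid (Skeleton 𝓡))
  | cell (p q p' q' : FreeGroup X) (s t : 𝓡) {a b c d : Skeleton 𝓡}
      (α : a ⟶ b) (β : b ⟶ d) (γ : a ⟶ c) (δ : c ⟶ d)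
      (hα : α.1 = ⟨p, s, q * p' * lhs t * q'⟩) (hβ : β.1 = ⟨p * rhs s * q * p', t, q'⟩)
      (hγ : γ.1 = ⟨p * lhs s * q * p', t, q'⟩) (hδ : δ.1 = ⟨p, s, q * p' * rhs t * q'⟩) :
      Cell ((Quiver.FreeGroupoid.of _).map α ≫ (Quiver.FreeGroupoid.of _).map β)
        ((Quiver.FreeGroupoid.of _).map γ ≫ (Quiver.FreeGroupoid.of _).map δ)

/-- The groupoid of edge paths modulo free reduction and the 2-cells. -/
abbrev PathQuotient : Type u := CategoryTheory.Quotient (Cell 𝓡)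

/-- The fundamental groupoid of the reduced Squier complex; its vertex set is `F(X)`. -/
def FundGpd (_ : Set (Word X × Word X)) : Type u := FreeGroup X

instance : Group (FundGpd 𝓡) := inferInstanceAs (Group (FreeGroup X))

/-- A vertex, as an object of the path groupoid. -/
def FundGpd.obj (a : FundGpd 𝓡) : PathQuotient 𝓡 := ⟨(Quiver.FreeGroupoid.of (Skeleton 𝓡)).obj a⟩

instance FundGpd.instGroupoid : Groupoid (FundGpd 𝓡) where
  Hom a b := FundGpd.obj 𝓡 a ⟶ FundGpd.obj 𝓡 b
  id a := 𝟙 (FundGpd.obj 𝓡 a)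
  comp f g := CategoryStruct.comp (obj := PathQuotient 𝓡) f g
  id_comp f := Category.id_comp (obj := PathQuotient 𝓡) f
  comp_id f := Category.comp_id (obj := PathQuotient 𝓡) f
  assoc f g h := Category.assoc (obj := PathQuotient 𝓡) f g h
  inv f := Groupoid.inv (obj := PathQuotient 𝓡) f
  inv_comp f := Groupoid.inv_comp (obj := PathQuotient 𝓡) f
  comp_inv f := Groupoid.comp_inv (obj := PathQuotient 𝓡) f

variable {𝓡}

/-- The homotopy class of a single edge, as an arrow of the fundamental groupoid. -/
def edgeHom {a b : FundGpd 𝓡} (e : Edge 𝓡) (ha : e.src = a) (hb : e.tgt = b) : a ⟶ b :=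
  (CategoryTheory.Quotient.functor (Cell 𝓡)).map
    ((Quiver.FreeGroupoid.of (Skeleton 𝓡)).map
      (X := (a : FreeGroup X)) (Y := (b : FreeGroup X)) ⟨e, ha, hb⟩)

theorem edgeHom_square {a b c d : FundGpd 𝓡} (p q p' q' : FreeGroup X) (s t : 𝓡)
    (h1 h2 h3 h4 h5 h6 h7 h8) :
    (edgeHom (a := a) (b := b) ⟨p, s, q * p' * lhs t * q'⟩ h1 h2 ≫
      edgeHom (b := d) ⟨p * rhs s * q * p', t, q'⟩ h3 h4) =
    (edgeHom (b := c) ⟨p * lhs s * q * p', t, q'⟩ h5 h6 ≫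
      edgeHom ⟨p, s, q * p' * rhs t * q'⟩ h7 h8) :=
  CategoryTheory.Quotient.sound (Cell 𝓡)
    (Cell.cell p q p' q' s t (a := (a : FreeGroup X)) (b := (b : FreeGroup X))
      (c := (c : FreeGroup X)) (d := (d : FreeGroup X)) ⟨_, h1, h2⟩ ⟨_, h3, h4⟩ ⟨_, h5, h6⟩
      ⟨_, h7, h8⟩ rfl rfl rfl rfl)

theorem FundGpd.induction {P : ∀ {a b : FundGpd 𝓡}, (a ⟶ b) → Prop}
    (id : ∀ a, P (𝟙 a))
    (edge : ∀ {a b : FundGpd 𝓡} (e : Edge 𝓡) (ha : e.src = a) (hb : e.tgt = b), P (edgeHom e ha hb))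
    (inv : ∀ {a b} (f : a ⟶ b), P f → P (Groupoid.inv f))
    (comp : ∀ {a b c} (f : a ⟶ b) (g : b ⟶ c), P f → P g → P (f ≫ g)) :
    ∀ {a b : FundGpd 𝓡} (f : a ⟶ b), P f := by
  intro a b f
  obtain ⟨⟨f⟩⟩ := f
  change Quiver.Path (V := Quiver.Symmetrify (Skeleton 𝓡)) a b at f
  revert f
  suffices H : ∀ (a b : Quiver.Symmetrify (Skeleton 𝓡)) (f : Quiver.Path a b),
      P (a := (a : FreeGroup X)) (b := (b : FreeGroup X)) (Quot.mk _ (Quot.mk _ f)) from H a b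
  intro a b f
  induction f with
  | nil => exact id a
  | @cons b c p e ih =>
    refine comp (b := (b : FreeGroup X)) (c := (c : FreeGroup X)) _
      (Quot.mk _ (Quot.mk _ (Quiver.Hom.toPath e))) ih ?_
    rcases e with e | e
    · exact edge e.1 e.2.1 e.2.2
    · exact inv _ (edge e.1 e.2.1 e.2.2)

/-- A map of the 1-skeleton to a groupoid under which the 2-cells commute extends to the
fundamental groupoid. -/
def FundGpd.lift {D : Type v} [Groupoid.{w} D] (φ : Skeleton 𝓡 ⥤q D)
    (H : ∀ (a b : Quiver.FreeGroupoid (Skeleton 𝓡)) (f g : a ⟶ b), Cell 𝓡 f g →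
      (Quiver.FreeGroupoid.lift φ).map f = (Quiver.FreeGroupoid.lift φ).map g) :
    FundGpd 𝓡 ⥤ D where
  obj := φ.obj
  map f := (CategoryTheory.Quotient.lift (Cell 𝓡) (Quiver.FreeGroupoid.lift φ) H).map f
  map_id _ := (CategoryTheory.Quotient.lift (Cell 𝓡) (Quiver.FreeGroupoid.lift φ) H).map_id _
  map_comp f g :=
    (CategoryTheory.Quotient.lift (Cell 𝓡) (Quiver.FreeGroupoid.lift φ) H).map_comp f g

theorem freeLift_of {D : Type v} [Groupoid.{w} D] (φ : Skeleton 𝓡 ⥤q D) {a b : Skeleton 𝓡}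
    (e : a ⟶ b) :
    (Quiver.FreeGroupoid.lift φ).map ((Quiver.FreeGroupoid.of _).map e) = φ.map e :=
  Category.id_comp (φ.map e)

theorem FundGpd.lift_edge {D : Type v} [Groupoid.{w} D] (φ : Skeleton 𝓡 ⥤q D) (H)
    {a b : FundGpd 𝓡} (e : Edge 𝓡) (ha : e.src = a) (hb : e.tgt = b) :
    (FundGpd.lift φ H).map (edgeHom e ha hb) =
      φ.map (X := (a : FreeGroup X)) (Y := (b : FreeGroup X)) ⟨e, ha, hb⟩ :=
  freeLift_of φ _

theorem edgeHom_congr {a b a' b' : FundGpd 𝓡} {e e' : Edge 𝓡} {ha hb ha' hb'} (h : e = e') :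
    edgeHom (a := a) (b := b) e ha hb ≍ edgeHom (a := a') (b := b') e' ha' hb' := by
  subst h ha hb ha' hb'
  rfl

/-- `x ▷ (p, l, r, q) = (x p, l, r, q)`. -/
def Edge.left (x : FreeGroup X) (e : Edge 𝓡) : Edge 𝓡 := ⟨x * e.p, e.rel, e.q⟩

/-- `(p, l, r, q) ◁ x = (p, l, r, q x)`. -/
def Edge.right (e : Edge 𝓡) (x : FreeGroup X) : Edge 𝓡 := ⟨e.p, e.rel, e.q * x⟩

theorem Edge.left_src (x : FreeGroup X) (e : Edge 𝓡) : (e.left x).src = x * e.src := by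
  simp [Edge.left, Edge.src, mul_assoc]

theorem Edge.left_tgt (x : FreeGroup X) (e : Edge 𝓡) : (e.left x).tgt = x * e.tgt := by
  simp [Edge.left, Edge.tgt, mul_assoc]

theorem Edge.right_src (e : Edge 𝓡) (x : FreeGroup X) : (e.right x).src = e.src * x := by
  simp [Edge.right, Edge.src, mul_assoc]

theorem Edge.right_tgt (e : Edge 𝓡) (x : FreeGroup X) : (e.right x).tgt = e.tgt * x := by
  simp [Edge.right, Edge.tgt, mul_assoc]

theorem Edge.left_src' {x a : FundGpd 𝓡} {e : Edge 𝓡} (h : e.src = a) :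
    (e.left x).src = x * a := by
  subst h
  exact Edge.left_src _ _

theorem Edge.left_tgt' {x a : FundGpd 𝓡} {e : Edge 𝓡} (h : e.tgt = a) :
    (e.left x).tgt = x * a := by
  subst h
  exact Edge.left_tgt _ _

theorem Edge.right_src' {x a : FundGpd 𝓡} {e : Edge 𝓡} (h : e.src = a) :
    (e.right x).src = a * x := by
  subst h
  exact Edge.right_src _ _

theorem Edge.right_tgt' {x a : FundGpd 𝓡} {e : Edge 𝓡} (h : e.tgt = a) :
    (e.right x).tgt = a * x := by
  subst h
  exact Edge.right_tgt _ _

/-- Left translation of edges by `x`. -/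
def leftPre (x : FreeGroup X) : Skeleton 𝓡 ⥤q FundGpd 𝓡 where
  obj (a : FreeGroup X) := (x * a : FreeGroup X)
  map e := edgeHom (e.1.left x)
    ((Edge.left_src x e.1).trans (congrArg (fun y : FreeGroup X => x * y) e.2.1))
    ((Edge.left_tgt x e.1).trans (congrArg (fun y : FreeGroup X => x * y) e.2.2))

/-- Right translation of edges by `x`. -/
def rightPre (x : FreeGroup X) : Skeleton 𝓡 ⥤q FundGpd 𝓡 where
  obj (a : FreeGroup X) := (a * x : FreeGroup X)
  map e := edgeHom (e.1.right x)
    ((Edge.right_src e.1 x).trans (congrArg (fun y : FreeGroup X => y * x) e.2.1))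
    ((Edge.right_tgt e.1 x).trans (congrArg (fun y : FreeGroup X => y * x) e.2.2))

/-- Left translation by `x` on the fundamental groupoid. -/
def leftFunctor (x : FreeGroup X) : FundGpd 𝓡 ⥤ FundGpd 𝓡 :=
  FundGpd.lift (leftPre x) (by
    rintro _ _ _ _ ⟨p, q, p', q', s, t, ⟨α, a1, a2⟩, ⟨β, b1, b2⟩, ⟨γ, c1, c2⟩, ⟨δ, d1, d2⟩,
      hα, hβ, hγ, hδ⟩
    dsimp only at hα hβ hγ hδ
    subst hα hβ hγ hδ
    rw [Functor.map_comp, Functor.map_comp, freeLift_of, freeLift_of, freeLift_of, freeLift_of]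
    have e1 : Edge.left x (⟨p * rhs s * q * p', t, q'⟩ : Edge 𝓡) =
        ⟨x * p * rhs s * q * p', t, q'⟩ := by simp [Edge.left, mul_assoc]
    have e2 : Edge.left x (⟨p * lhs s * q * p', t, q'⟩ : Edge 𝓡) =
        ⟨x * p * lhs s * q * p', t, q'⟩ := by simp [Edge.left, mul_assoc]
    simp only [leftPre, e1, e2]
    exact edgeHom_square (x * p) q p' q' s t _ _ _ _ _ _ _ _)

/-- Right translation by `x` on the fundamental groupoid. -/
def rightFunctor (x : FreeGroup X) : FundGpd 𝓡 ⥤ FundGpd 𝓡 :=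
  FundGpd.lift (rightPre x) (by
    rintro _ _ _ _ ⟨p, q, p', q', s, t, ⟨α, a1, a2⟩, ⟨β, b1, b2⟩, ⟨γ, c1, c2⟩, ⟨δ, d1, d2⟩,
      hα, hβ, hγ, hδ⟩
    dsimp only at hα hβ hγ hδ
    subst hα hβ hγ hδ
    rw [Functor.map_comp, Functor.map_comp, freeLift_of, freeLift_of, freeLift_of, freeLift_of]
    have e1 : Edge.right (⟨p, s, q * p' * lhs t * q'⟩ : Edge 𝓡) x =
        ⟨p, s, q * p' * lhs t * (q' * x)⟩ := by simp [Edge.right, mul_assoc]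
    have e2 : Edge.right (⟨p, s, q * p' * rhs t * q'⟩ : Edge 𝓡) x =
        ⟨p, s, q * p' * rhs t * (q' * x)⟩ := by simp [Edge.right, mul_assoc]
    simp only [rightPre, e1, e2]
    exact edgeHom_square p q p' (q' * x) s t _ _ _ _ _ _ _ _)

theorem leftFunctor_edge (x : FundGpd 𝓡) {a b : FundGpd 𝓡} (e : Edge 𝓡) (ha : e.src = a)
    (hb : e.tgt = b) : (leftFunctor x).map (edgeHom e ha hb) =
      edgeHom (b := x * b) (e.left x) (Edge.left_src' ha) (Edge.left_tgt' hb) :=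
  FundGpd.lift_edge _ _ _ _ _

theorem rightFunctor_edge (x : FundGpd 𝓡) {a b : FundGpd 𝓡} (e : Edge 𝓡) (ha : e.src = a)
    (hb : e.tgt = b) : (rightFunctor x).map (edgeHom e ha hb) =
      edgeHom (b := b * x) (e.right x) (Edge.right_src' ha) (Edge.right_tgt' hb) :=
  FundGpd.lift_edge _ _ _ _ _

/-- Two functors between fundamental groupoids that agree on vertices and edges agree on arrows. -/
theorem functor_heq {F G : FundGpd 𝓡 ⥤ FundGpd 𝓡} (hobj : ∀ a, F.obj a = G.obj a)
    (hedge : ∀ {a b : FundGpd 𝓡} (e : Edge 𝓡) (ha : e.src = a) (hb : e.tgt = b),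
      F.map (edgeHom e ha hb) ≍ G.map (edgeHom e ha hb))
    {a b : FundGpd 𝓡} (f : a ⟶ b) : F.map f ≍ G.map f := by
  refine FundGpd.induction (P := fun {a b} f => F.map f ≍ G.map f) ?_ hedge ?_ ?_ f
  · intro a
    rw [F.map_id, G.map_id, hobj]
  · intro a b f hf
    rw [Groupoid.inv_eq_inv, Functor.map_inv, Functor.map_inv, ← Groupoid.inv_eq_inv,
      ← Groupoid.inv_eq_inv]
    exact inv_heq' (hobj _) (hobj _) hf
  · intro a b c f g hf hg
    rw [F.map_comp, G.map_comp]
    exact comp_heq' (hobj _) (hobj _) (hobj _) hf hg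

/-- The fundamental groupoid of the reduced Squier complex is regular, for the translation
actions determined by `x ▷ (p, l, r, q) = (x p, l, r, q)`, `(p, l, r, q) ◁ x = (p, l, r, q x)`. -/
instance FundGpd.instRegular : RegularGroupoid.{u, u} (FundGpd 𝓡) where
  wl x {a b} f := (leftFunctor x).map f
  wr {a b} f x := (rightFunctor x).map f
  wl_id x a := (leftFunctor x).map_id a
  wr_id a x := (rightFunctor x).map_id a
  wl_comp x {a b c} f g := (leftFunctor x).map_comp f g
  wr_comp f g x := (rightFunctor x).map_comp f g
  wl_mul x y {a b} f :=
    functor_heq (F := leftFunctor (x * y)) (G := leftFunctor y ⋙ leftFunctor x)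
      (fun a => mul_assoc x y a)
      (fun {a b} e ha hb => by
        refine (heq_of_eq (leftFunctor_edge (x * y) e ha hb)).trans (HEq.trans ?_ (heq_of_eq
          ((congrArg (leftFunctor x).map (leftFunctor_edge y e ha hb)).trans
            (leftFunctor_edge x _ _ _))).symm)
        refine edgeHom_congr ?_
        exact Edge.ext (mul_assoc _ _ _) rfl rfl) f
  wr_mul {a b} f x y :=
    functor_heq (F := rightFunctor (x * y)) (G := rightFunctor x ⋙ rightFunctor y)
      (fun a => (mul_assoc a x y).symm)
      (fun {a b} e ha hb => by
        refine (heq_of_eq (rightFunctor_edge (x * y) e ha hb)).trans (HEq.trans ?_ (heq_of_eq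
          ((congrArg (rightFunctor y).map (rightFunctor_edge x e ha hb)).trans
            (rightFunctor_edge y _ _ _))).symm)
        refine edgeHom_congr ?_
        exact Edge.ext rfl rfl (mul_assoc _ _ _).symm) f
  wl_wr x {a b} f y :=
    functor_heq (F := leftFunctor x ⋙ rightFunctor y) (G := rightFunctor y ⋙ leftFunctor x)
      (fun a => mul_assoc x a y)
      (fun {a b} e ha hb => by
        refine (heq_of_eq ((congrArg (rightFunctor y).map (leftFunctor_edge x e ha hb)).trans
            (rightFunctor_edge y _ _ _))).trans (HEq.trans ?_ (heq_of_eq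
          ((congrArg (leftFunctor x).map (rightFunctor_edge y e ha hb)).trans
            (leftFunctor_edge x _ _ _))).symm)
        refine edgeHom_congr ?_
        exact Edge.ext rfl rfl rfl) f
  wl_one {a b} f :=
    functor_heq (F := leftFunctor 1) (G := 𝟭 _) (fun a => one_mul a)
      (fun {a b} e ha hb => by
        refine (heq_of_eq (leftFunctor_edge 1 e ha hb)).trans ?_
        refine edgeHom_congr (ha' := ha) (hb' := hb) ?_
        exact Edge.ext (one_mul _) rfl rfl) f
  wr_one {a b} f :=
    functor_heq (F := rightFunctor 1) (G := 𝟭 _) (fun a => mul_one a)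
      (fun {a b} e ha hb => by
        refine (heq_of_eq (rightFunctor_edge 1 e ha hb)).trans ?_
        refine edgeHom_congr (ha' := ha) (hb' := hb) ?_
        exact Edge.ext rfl rfl (mul_one _)) f

open RegularGroupoid

theorem edge_interchange (e f : Edge 𝓡) {a b c d : FundGpd 𝓡} (ha : e.src = a) (hb : e.tgt = b)
    (hc : f.src = c) (hd : f.tgt = d) :
    wr (edgeHom e ha hb) c ≫ wl b (edgeHom f hc hd) =
      wl a (edgeHom f hc hd) ≫ wr (edgeHom e ha hb) d := by
  have E1 := rightFunctor_edge c e ha hb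
  have E2 := rightFunctor_edge d e ha hb
  have E3 := leftFunctor_edge a f hc hd
  have E4 := leftFunctor_edge b f hc hd
  change (rightFunctor c).map _ ≫ (leftFunctor b).map _ =
    (leftFunctor a).map _ ≫ (rightFunctor d).map _
  rw [E1, E2, E3, E4]
  subst ha hb hc hd
  have r1 : Edge.right e f.src = ⟨e.p, e.rel, e.q * f.p * lhs f.rel * f.q⟩ := by
    simp [Edge.right, Edge.src, mul_assoc]
  have r2 : Edge.right e f.tgt = ⟨e.p, e.rel, e.q * f.p * rhs f.rel * f.q⟩ := by
    simp [Edge.right, Edge.tgt, mul_assoc]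
  have r3 : Edge.left e.src f = ⟨e.p * lhs e.rel * e.q * f.p, f.rel, f.q⟩ := rfl
  have r4 : Edge.left e.tgt f = ⟨e.p * rhs e.rel * e.q * f.p, f.rel, f.q⟩ := rfl
  simp only [r1, r2, r3, r4]
  exact edgeHom_square e.p e.q f.p f.q e.rel f.rel _ _ _ _ _ _ _ _

theorem interchange {a b c d : FundGpd 𝓡} (f : a ⟶ b) (g : c ⟶ d) :
    wr f c ≫ wl b g = wl a g ≫ wr f d := by
  refine FundGpd.induction
    (P := fun {a b} f => ∀ {c d : FundGpd 𝓡} (g : c ⟶ d), wr f c ≫ wl b g = wl a g ≫ wr f d)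
    ?_ ?_ ?_ ?_ f g
  · intro a c d g
    rw [wr_id, wr_id, Category.id_comp, Category.comp_id]
  · intro a b e ha hb c d g
    refine FundGpd.induction
      (P := fun {c d} g => wr (edgeHom e ha hb) c ≫ wl b g = wl a g ≫ wr (edgeHom e ha hb) d)
      ?_ ?_ ?_ ?_ g
    · intro c
      rw [wl_id, wl_id, Category.id_comp, Category.comp_id]
    · intro c d e' hc hd
      exact edge_interchange e e' ha hb hc hd
    · intro c d g hg
      rw [wl_inv, wl_inv, Groupoid.inv_eq_inv, Groupoid.inv_eq_inv, IsIso.eq_inv_comp,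
        ← Category.assoc, IsIso.comp_inv_eq, hg]
    · intro c d k g h hg hh
      rw [wl_comp, wl_comp, ← Category.assoc, hg, Category.assoc, hh, Category.assoc]
  · intro a b f hf c d g
    rw [wr_inv, wr_inv, Groupoid.inv_eq_inv, Groupoid.inv_eq_inv, IsIso.inv_comp_eq,
      ← Category.assoc, IsIso.eq_comp_inv, hf]
  · intro a b k f f' hf hf' c d g
    rw [wr_comp, wr_comp, Category.assoc, hf', ← Category.assoc, hf, Category.assoc]

theorem fundGpd_isMonoidal : IsMonoidal (FundGpd 𝓡) := fun α β =>
  Elt.ext rfl rfl (heq_of_eq (interchange α.hom β.hom))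

variable (𝓡)

/-- The crossed `F(X)`-module `r : star₁(Sq(𝓡)) → F(X)`. -/
def squierCrossedModule : CrossedModule.{u, u} (FreeGroup X) :=
  starCrossedModule (V := FundGpd 𝓡) fundGpd_isMonoidal

/-- The free crossed `F(X)`-module `C → F(X)` derived from the presentation. -/
def presentationCrossedModule : CrossedModule.{u, u} (FreeGroup X) :=
  freeCrossedModule (rhoHat (𝓡 := 𝓡))

/-- The element `(s, u)` of `C`. -/
def basisElt (s : 𝓡) (u : FreeGroup X) : (presentationCrossedModule 𝓡).carrier :=
  FreeCM.gen rhoHat s u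

/-- The class in `star₁` of the edge `(u⁻¹ l⁻¹, l, r, u)`, for the relation `s = (l, r)`. -/
def lam (s : 𝓡) (u : FreeGroup X) : (squierCrossedModule 𝓡).carrier :=
  (⟨⟨(⟨u⁻¹ * (lhs s)⁻¹, s, u⟩ : Edge 𝓡).src, (⟨u⁻¹ * (lhs s)⁻¹, s, u⟩ : Edge 𝓡).tgt,
      edgeHom ⟨u⁻¹ * (lhs s)⁻¹, s, u⟩ rfl rfl⟩, by
    change u⁻¹ * (lhs s)⁻¹ * lhs s * u = 1
    group⟩ : starOne (FundGpd 𝓡))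

end Complex

end Squier

/-! The 2-cells of the reduced Squier complex and the Peiffer relations of `C` are the same
relations. Forgetting the left context sends an edge $(p,l,r,q)$ to the generator $(l,r,q)$, and a
2-cell then says $(l,r,qp'l'q')\,(l',r',q') = (l',r',q')\,(l,r,qp'r'q')$. This is the Peiffer
relation for conjugation by $(l',r',q')$, because $(qp'l'q')\,q'^{-1}\hat\rho(l',r')\,q' = qp'r'q'$.
So every arrow of $\pi$ has a well-defined label in `C`, multiplicative along paths (`label_comp`).

Labels ignore left translation (`label_wl`), turn right translation into the action of `C`
(`label_wr`), and have boundary $a^{-1}b$ on an arrow from $a$ to $b$ (`bd_label`). Restricted to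
arrows starting at $1$, the label is therefore a morphism of crossed modules.

Its inverse comes from the universal property of `C`: the group $\operatorname{star}_1$ satisfies
the Peiffer identity, so $(l,r,1)\mapsto\lambda_{l,r,1}$ extends to a homomorphism, which sends
$(l,r,u)$ to $\lambda_{l,r,u}$. One composite is the identity on generators. For the other, an arrow
$f$ from $a$ is moved to $a^{-1}\rhd f$, which starts at $1$. This is multiplicative in $f$
(`Elt.ofHom_comp`) and sends $(p,l,r,q)$ to $\lambda_{l,r,q}$ (`ofHom_edgeHom`), so induction on
arrows recovers $a^{-1}\rhd f$ from the label of $f$ (`lamHom_label`). At $a=1$ this is $f$ itself.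
-/

namespace Squier

open CategoryTheory RegularGroupoid

/-! ## The universal property of Whitehead's construction -/

section UniversalProperty

variable {Γ : Type u} [Group Γ] {R : Type v} (ω : R → Γ)

/-- Every generator `(r, u)` is the translate by `u` of `(r, 1)`. -/
theorem FreeCM.gen_eq_actHom (r : R) (g : Γ) :
    FreeCM.gen ω r g = FreeCM.actHom ω g (FreeCM.gen ω r 1) := by
  simp

theorem CrossedModule.act_one_left {T : CrossedModule.{u, w} Γ} (g : Γ) : T.act 1 g = 1 := by
  have h := T.mul_act 1 1 g
  rwa [mul_one, left_eq_mul] at h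

variable {ω} {T : CrossedModule.{u, w} Γ} (σ : R → T.carrier) (hσ : ∀ r, T.bd (σ r) = ω r)

/-- The homomorphism `(r, u) ↦ (σ r) ^ u` to a crossed module. -/
def FreeCM.liftHom : FreeCM ω →* T.carrier :=
  PresentedGroup.toGroup (f := fun x : R × Γ => T.act (σ x.1) x.2) (by
    rintro _ ⟨r, s, g, h, rfl⟩
    -- The last exponent in the Peiffer element is `h` times the boundary of the image of `(r, g)`,
    -- so the Peiffer identity in `T` turns that factor into a conjugate and the product cancels.
    have e : h * g⁻¹ * ω r * g = h * T.bd (T.act (σ r) g) := by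
      rw [T.bd_act, hσ]
      group
    simp only [map_mul, map_inv, FreeGroup.lift_apply_of, e, T.act_mul, T.peiffer]
    group)

@[simp] theorem FreeCM.liftHom_gen (r : R) (g : Γ) :
    FreeCM.liftHom σ hσ (FreeCM.gen ω r g) = T.act (σ r) g :=
  PresentedGroup.toGroup.of _

/-- The action of `g` as an endomorphism of the underlying group. -/
def CrossedModule.actMonoidHom (T : CrossedModule.{u, w} Γ) (g : Γ) : T.carrier →* T.carrier where
  toFun t := T.act t g
  map_one' := CrossedModule.act_one_left g
  map_mul' t s := T.mul_act t s g

/-- The morphism of crossed modules extending `σ`. -/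
def FreeCM.lift : CrossedModule.Hom (freeCrossedModule ω) T where
  toHom := FreeCM.liftHom σ hσ
  map_act t g := by
    have h : (FreeCM.liftHom σ hσ).comp (FreeCM.actHom ω g) =
        (T.actMonoidHom g).comp (FreeCM.liftHom σ hσ) :=
      FreeCM.hom_ext ω fun r u => by simp [CrossedModule.actMonoidHom, T.act_mul]
    exact DFunLike.congr_fun h t
  bd_map t := by
    have h : T.bd.comp (FreeCM.liftHom σ hσ) = FreeCM.bd ω :=
      FreeCM.hom_ext ω fun r u => by simp [T.bd_act, hσ]
    exact DFunLike.congr_fun h t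

-- Uniqueness holds because the elements `(r, 1)` generate under the action: equivariance forces the
-- value $\sigma(r)^u$ on `(r, u)`.
variable (ω) in
theorem freeCrossedModule_isFree :
    CrossedModule.IsFree.{u, max u v, w} (freeCrossedModule ω) fun r => FreeCM.gen ω r 1 := by
  intro T σ hσ
  have hσ' : ∀ r, T.bd (σ r) = ω r := fun r => by
    rw [hσ r]
    exact (FreeCM.bd_gen ω r 1).trans (by simp)
  refine ⟨FreeCM.lift σ hσ', fun r => (FreeCM.liftHom_gen σ hσ' r 1).trans (T.act_one _), ?_⟩
  intro φ hφ
  have h : φ.toHom = (FreeCM.lift σ hσ').toHom := by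
    refine FreeCM.hom_ext ω fun r g => ?_
    refine Eq.trans ?_ (FreeCM.liftHom_gen σ hσ' r g).symm
    rw [← hφ r, FreeCM.gen_eq_actHom]
    exact φ.map_act _ g
  cases φ
  congr

end UniversalProperty

/-! ## Elements of regular groupoids -/

section Elements

variable {V : Type u} [Group V] [RegularGroupoid.{u, v} V]

/-- The identity arrow at `a`, as an element. -/
def Elt.idAt (a : V) : Elt V := ⟨a, a, 𝟙 a⟩

theorem Elt.idAt_one : Elt.idAt (1 : V) = 1 := rfl

/-- The identity arrows form a copy of `V` inside the group of elements. Translations thus become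
multiplications, and `Elt.ofHom` can be handled by group algebra. -/
theorem Elt.idAt_mul (a b : V) : Elt.idAt (a * b) = Elt.idAt a * Elt.idAt b := by
  refine Elt.ext rfl rfl (heq_of_eq ?_)
  change 𝟙 (a * b) = wr (𝟙 a) b ≫ wl a (𝟙 b)
  rw [wl_id, wr_id, Category.comp_id]

theorem Elt.idAt_inv (a : V) : (Elt.idAt a)⁻¹ = Elt.idAt a⁻¹ := by
  rw [inv_eq_iff_mul_eq_one, ← Elt.idAt_mul, mul_inv_cancel, Elt.idAt_one]

theorem Elt.idAt_mul_eq_lact (x : V) (α : Elt V) : Elt.idAt x * α = α.lact x := by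
  refine Elt.ext rfl rfl (heq_of_eq ?_)
  change wr (𝟙 x) α.d ≫ wl x α.hom = wl x α.hom
  rw [wr_id, Category.id_comp]

/-- The left translate of an arrow that starts at `1`. -/
def Elt.ofHom {a b : V} (f : a ⟶ b) : Elt V := (Elt.idAt a)⁻¹ * ⟨a, b, f⟩

theorem Elt.ofHom_id (a : V) : Elt.ofHom (𝟙 a) = 1 := inv_mul_cancel (Elt.idAt a)

/-- In $f * (b^{-1}\rhd g)$ the second factor starts at $1$, so $f$ is not translated, while the end
$b$ of $f$ moves $b^{-1}\rhd g$ back to $g$. The product is the composite of $f$ and $g$. -/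
theorem Elt.ofHom_comp {a b c : V} (f : a ⟶ b) (g : b ⟶ c) :
    Elt.ofHom (f ≫ g) = Elt.ofHom f * Elt.ofHom g := by
  have h : (⟨a, c, f ≫ g⟩ : Elt V) = ⟨a, b, f⟩ * Elt.ofHom g := by
    rw [Elt.ofHom, Elt.idAt_inv, Elt.idAt_mul_eq_lact]
    have e : b * (b⁻¹ * c) = c := mul_inv_cancel_left b c
    refine Elt.ext (by change a = a * (b⁻¹ * b); group) e.symm ?_
    change f ≫ g ≍ wr f (b⁻¹ * b) ≫ wl b (wl b⁻¹ g)
    refine comp_heq' (by group) (by group) e.symm ?_ ?_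
    · exact ((wr_heq (inv_mul_cancel b) rfl rfl HEq.rfl).trans (wr_one f)).symm
    · refine HEq.trans ?_ (wl_mul b b⁻¹ g)
      exact ((wl_heq (mul_inv_cancel b) rfl rfl HEq.rfl).trans (wl_one g)).symm
  rw [Elt.ofHom, h, ← mul_assoc]
  rfl

theorem Elt.ofHom_inv {a b : V} (f : a ⟶ b) :
    Elt.ofHom (Groupoid.inv f) = (Elt.ofHom f)⁻¹ := by
  rw [eq_inv_iff_mul_eq_one, ← Elt.ofHom_comp, Groupoid.inv_comp, Elt.ofHom_id]

end Elements

/-! ## The isomorphism -/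

section Isomorphism

variable {X : Type u} {𝓡 : Set (Word X × Word X)}

/-! ### Labels of arrows in the group `C` -/

/-- The edge map `(p, l, r, q) ↦ (l, r, q)` to the group `C`, viewed as a groupoid with one
object; the opposite group matches the order of composition. -/
def labelPre : Skeleton 𝓡 ⥤q SingleObj (FreeCM (rhoHat (𝓡 := 𝓡)))ᵐᵒᵖ where
  obj _ := SingleObj.star _
  map e := MulOpposite.op (FreeCM.gen rhoHat e.1.rel e.1.q)

/-- The functor induced by `(p, l, r, q) ↦ (l, r, q)` on the fundamental groupoid. -/
def labelFunctor : FundGpd 𝓡 ⥤ SingleObj (FreeCM (rhoHat (𝓡 := 𝓡)))ᵐᵒᵖ :=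
  FundGpd.lift labelPre (by
    rintro _ _ _ _ ⟨p, q, p', q', s, t, ⟨α, a1, a2⟩, ⟨β, b1, b2⟩, ⟨γ, c1, c2⟩, ⟨δ, d1, d2⟩,
      hα, hβ, hγ, hδ⟩
    dsimp only at hα hβ hγ hδ
    subst hα hβ hγ hδ
    rw [Functor.map_comp, Functor.map_comp, freeLift_of, freeLift_of, freeLift_of, freeLift_of]
    refine congrArg MulOpposite.op (?_ : FreeCM.gen rhoHat s _ * FreeCM.gen rhoHat t _ =
      FreeCM.gen rhoHat t _ * FreeCM.gen rhoHat s _)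
    -- The edge labelled `(t, q')` does the conjugating. Passing it replaces `lhs t` by `rhs t` in
    -- the right context of `s`.
    have h := FreeCM.rel rhoHat t s q' (q * p' * lhs t * q')
    have e : q * p' * lhs t * q' * q'⁻¹ * rhoHat t * q' = q * p' * rhs t * q' := by
      simp [rhoHat, mul_assoc]
    rw [e, mul_assoc, mul_assoc, inv_mul_eq_one, eq_inv_mul_iff_mul_eq] at h
    exact h)

/-- The element of `C` spelled by an arrow of the fundamental groupoid. -/
def label {a b : FundGpd 𝓡} (f : a ⟶ b) : FreeCM (rhoHat (𝓡 := 𝓡)) :=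
  MulOpposite.unop (labelFunctor.map f)

theorem label_id (a : FundGpd 𝓡) : label (𝟙 a) = 1 :=
  congrArg MulOpposite.unop (labelFunctor.map_id a)

theorem label_comp {a b c : FundGpd 𝓡} (f : a ⟶ b) (g : b ⟶ c) :
    label (f ≫ g) = label f * label g :=
  congrArg MulOpposite.unop (labelFunctor.map_comp f g)

theorem label_edgeHom {a b : FundGpd 𝓡} (e : Edge 𝓡) (ha : e.src = a) (hb : e.tgt = b) :
    label (edgeHom e ha hb) = FreeCM.gen rhoHat e.rel e.q :=
  congrArg MulOpposite.unop (FundGpd.lift_edge labelPre _ e ha hb)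

theorem label_inv {a b : FundGpd 𝓡} (f : a ⟶ b) : label (Groupoid.inv f) = (label f)⁻¹ := by
  rw [eq_inv_iff_mul_eq_one, ← label_comp, Groupoid.inv_comp, label_id]

/-- Left translation changes only the component `p` of an edge, which the label discards. -/
theorem label_wl (x : FundGpd 𝓡) {a b : FundGpd 𝓡} (f : a ⟶ b) : label (wl x f) = label f := by
  refine FundGpd.induction (P := fun f => label (wl x f) = label f) ?_ ?_ ?_ ?_ f
  · intro a
    rw [wl_id, label_id, label_id]
  · intro a b e ha hb
    rw [label_edgeHom]
    exact (congrArg label (leftFunctor_edge x e ha hb)).trans (label_edgeHom _ _ _)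
  · intro a b f hf
    rw [wl_inv, label_inv, label_inv, hf]
  · intro a b c f g hf hg
    rw [wl_comp, label_comp, label_comp, hf, hg]

/-- Right translation and the action on `C` both multiply the last component of a generator by `x`
on the right. -/
theorem label_wr {a b : FundGpd 𝓡} (f : a ⟶ b) (x : FundGpd 𝓡) :
    label (wr f x) = FreeCM.actHom rhoHat x (label f) := by
  refine FundGpd.induction (P := fun f => label (wr f x) = FreeCM.actHom rhoHat x (label f))
    ?_ ?_ ?_ ?_ f
  · intro a
    rw [wr_id, label_id, label_id, map_one]
  · intro a b e ha hb
    rw [label_edgeHom]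
    exact ((congrArg label (rightFunctor_edge x e ha hb)).trans (label_edgeHom _ _ _)).trans
      (FreeCM.actHom_gen rhoHat _ _ _).symm
  · intro a b f hf
    rw [wr_inv, label_inv, label_inv, hf, map_inv]
  · intro a b c f g hf hg
    rw [wr_comp, label_comp, label_comp, hf, hg, map_mul]

/-- For an edge, $q^{-1}l^{-1}rq=(plq)^{-1}(prq)$; along a path these quotients telescope. -/
theorem bd_label {a b : FundGpd 𝓡} (f : a ⟶ b) :
    FreeCM.bd rhoHat (label f) = (a⁻¹ * b : FundGpd 𝓡) := by
  refine FundGpd.induction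
    (P := fun {a b} f => FreeCM.bd rhoHat (label f) = (a⁻¹ * b : FundGpd 𝓡)) ?_ ?_ ?_ ?_ f
  · intro a
    rw [label_id, map_one, inv_mul_cancel]
    rfl
  · intro a b e ha hb
    rw [label_edgeHom, FreeCM.bd_gen]
    subst ha hb
    change _ = (e.p * lhs e.rel * e.q)⁻¹ * (e.p * rhs e.rel * e.q)
    rw [rhoHat]
    group
  · intro a b f hf
    rw [label_inv, map_inv, hf]
    exact (mul_inv_rev a⁻¹ b).trans (by rw [inv_inv])
  · intro a b c f g hf hg
    rw [label_comp, map_mul, hf, hg]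
    change (a⁻¹ * b * (b⁻¹ * c) : FundGpd 𝓡) = a⁻¹ * c
    group

/-! ### The label homomorphism on arrows starting at 1 -/

variable (𝓡)

/-- The homomorphism `star₁ → C` given by labels. -/
def labelHom : (squierCrossedModule 𝓡).carrier →* (presentationCrossedModule 𝓡).carrier where
  toFun (α : starOne (FundGpd 𝓡)) := label α.1.hom
  map_one' := label_id 1
  map_mul' (α β : starOne (FundGpd 𝓡)) := by
    change label (wr α.1.hom β.1.d ≫ wl α.1.r β.1.hom) = label α.1.hom * label β.1.hom
    have hβ : β.1.d = 1 := β.2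
    rw [label_comp, label_wl, label_wr]
    -- The right translation in the product is by the start of `β`, which is `1`, so it acts
    -- trivially on the label of `α`.
    refine congrArg (· * _) ?_
    refine (congrArg (fun g : FreeGroup X => FreeCM.actHom rhoHat g _) hβ).trans ?_
    exact DFunLike.congr_fun (FreeCM.actHom_one rhoHat) _

/-- In $g^{-1}\rhd\alpha\lhd g$ the label sees only the right translation. -/
theorem labelHom_act (α : (squierCrossedModule 𝓡).carrier) (g : FreeGroup X) :
    labelHom 𝓡 ((squierCrossedModule 𝓡).act α g) =
      (presentationCrossedModule 𝓡).act (labelHom 𝓡 α) g :=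
  (label_wr _ _).trans (congrArg (FreeCM.actHom rhoHat g) (label_wl _ _))

theorem bd_labelHom (α : (squierCrossedModule 𝓡).carrier) :
    (presentationCrossedModule 𝓡).bd (labelHom 𝓡 α) = (squierCrossedModule 𝓡).bd α := by
  obtain ⟨⟨a, b, f⟩, ha⟩ := α
  change a = 1 at ha
  subst ha
  refine (bd_label f).trans ?_
  rw [inv_one, one_mul]
  rfl

theorem labelHom_lam (s : 𝓡) (g : FreeGroup X) : labelHom 𝓡 (lam 𝓡 s g) = basisElt 𝓡 s g :=
  label_edgeHom ⟨g⁻¹ * (lhs s)⁻¹, s, g⟩ rfl rfl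

/-! ### The inverse homomorphism -/

theorem ofHom_edgeHom {a b : FundGpd 𝓡} (e : Edge 𝓡) (ha : e.src = a) (hb : e.tgt = b) :
    Elt.ofHom (edgeHom e ha hb) = (show starOne (FundGpd 𝓡) from lam 𝓡 e.rel e.q).1 := by
  subst ha hb
  refine (congrArg (· * _) (Elt.idAt_inv _)).trans ((Elt.idAt_mul_eq_lact _ _).trans ?_)
  -- Translating by $(plq)^{-1}$ replaces the left context by $(plq)^{-1}p=q^{-1}l^{-1}$, which is
  -- that of $\lambda_{l,r,q}$.
  have h : e.left (e.src)⁻¹ = ⟨e.q⁻¹ * (lhs e.rel)⁻¹, e.rel, e.q⟩ := by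
    refine Edge.ext ?_ rfl rfl
    change (e.p * lhs e.rel * e.q)⁻¹ * e.p = _
    group
  refine Elt.ext ?_ ?_ ?_
  · exact (Edge.left_src _ e).symm.trans (congrArg Edge.src h)
  · exact (Edge.left_tgt _ e).symm.trans (congrArg Edge.tgt h)
  · exact (heq_of_eq (leftFunctor_edge _ e rfl rfl)).trans
      (edgeHom_congr (ha' := rfl) (hb' := rfl) h)

/-- Reduces an equation between conjugated edge classes to one between edges. Leaving the endpoints
as variables lets them be substituted away, so that no transport of arrows remains. -/
theorem conjAct_edgeHom {a b a' b' : FundGpd 𝓡} (e e' : Edge 𝓡) (g : FundGpd 𝓡)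
    (ha : e.src = a) (hb : e.tgt = b) (ha' : e'.src = a') (hb' : e'.tgt = b')
    (h : (e.left g⁻¹).right g = e') :
    Elt.conjAct ⟨a, b, edgeHom e ha hb⟩ g = (⟨a', b', edgeHom e' ha' hb'⟩ : Elt (FundGpd 𝓡)) := by
  subst h ha' hb'
  refine Elt.ext ?_ ?_ ?_
  · exact (Edge.right_src' (Edge.left_src' ha)).symm
  · exact (Edge.right_tgt' (Edge.left_tgt' hb)).symm
  · exact HEq.trans (heq_of_eq ((congrArg (rightFunctor g).map
      (leftFunctor_edge g⁻¹ e ha hb)).trans (rightFunctor_edge g _ _ _)))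
      (edgeHom_congr (ha' := rfl) (hb' := rfl) rfl)

/-- Conjugating the edge $(l^{-1},l,r,1)$ by $g$ gives $(g^{-1}l^{-1},l,r,g)$. Hence the extension
of $(l,r,1)\mapsto\lambda_{l,r,1}$ takes the required value on every generator. -/
theorem act_lam (s : 𝓡) (g : FreeGroup X) :
    (squierCrossedModule 𝓡).act (lam 𝓡 s 1) g = lam 𝓡 s g := by
  refine Subtype.ext (conjAct_edgeHom 𝓡 _ _ g rfl rfl rfl rfl ?_)
  refine Edge.ext ?_ rfl (one_mul g)
  change g⁻¹ * (1⁻¹ * (lhs s)⁻¹) = _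
  group

theorem bd_lam_one (s : 𝓡) : (squierCrossedModule 𝓡).bd (lam 𝓡 s 1) = rhoHat s := by
  change 1⁻¹ * (lhs s)⁻¹ * rhs s * 1 = (lhs s)⁻¹ * rhs s
  group

/-- The homomorphism `C → star₁` with `(l, r, u) ↦ λ_{l,r,u}`. -/
def lamHom : (presentationCrossedModule 𝓡).carrier →* (squierCrossedModule 𝓡).carrier :=
  FreeCM.liftHom (fun s => lam 𝓡 s 1) (bd_lam_one 𝓡)

theorem lamHom_gen (s : 𝓡) (g : FreeGroup X) :
    lamHom 𝓡 (FreeCM.gen rhoHat s g) = lam 𝓡 s g :=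
  (FreeCM.liftHom_gen _ _ s g).trans (act_lam 𝓡 s g)

theorem labelHom_lamHom (c : (presentationCrossedModule 𝓡).carrier) :
    labelHom 𝓡 (lamHom 𝓡 c) = c := by
  have h : (labelHom 𝓡).comp (lamHom 𝓡) = MonoidHom.id _ :=
    FreeCM.hom_ext rhoHat fun s g =>
      (congrArg (labelHom 𝓡) (lamHom_gen 𝓡 s g)).trans (labelHom_lam 𝓡 s g)
  exact DFunLike.congr_fun h c

/-- Stated for arrows with any start, since the pieces of a path from $1$ need not start at $1$.
Both sides respect identities, inverses and composition, so single edges decide. -/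
theorem lamHom_label {a b : FundGpd 𝓡} (f : a ⟶ b) :
    (starOne (FundGpd 𝓡)).subtype (lamHom 𝓡 (label f)) = Elt.ofHom f := by
  let ψ : FreeCM (rhoHat (𝓡 := 𝓡)) →* Elt (FundGpd 𝓡) :=
    (starOne (FundGpd 𝓡)).subtype.comp (lamHom 𝓡)
  change ψ (label f) = Elt.ofHom f
  refine FundGpd.induction (P := fun f => ψ (label f) = Elt.ofHom f) ?_ ?_ ?_ ?_ f
  · intro a
    rw [label_id, map_one, Elt.ofHom_id]
  · intro a b e ha hb
    rw [label_edgeHom, ofHom_edgeHom]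
    exact congrArg (starOne (FundGpd 𝓡)).subtype (lamHom_gen 𝓡 e.rel e.q)
  · intro a b f hf
    rw [label_inv, map_inv, hf, Elt.ofHom_inv]
  · intro a b c f g hf hg
    rw [label_comp, map_mul, hf, hg, Elt.ofHom_comp]

theorem lamHom_labelHom (α : (squierCrossedModule 𝓡).carrier) :
    lamHom 𝓡 (labelHom 𝓡 α) = α := by
  obtain ⟨⟨a, b, f⟩, ha⟩ := α
  change a = 1 at ha
  subst ha
  refine Subtype.ext ((lamHom_label 𝓡 f).trans ?_)
  -- The arrow now starts at `1`, so its translate to `1` is the arrow itself.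
  rw [Elt.ofHom, Elt.idAt_one, inv_one, one_mul]

/-- The isomorphism `star₁ ≅ C` of crossed `F(X)`-modules. -/
def labelIso : CrossedModule.Iso (squierCrossedModule 𝓡) (presentationCrossedModule 𝓡) where
  toEquiv :=
    { labelHom 𝓡 with
      invFun := lamHom 𝓡
      left_inv := lamHom_labelHom 𝓡
      right_inv := labelHom_lamHom 𝓡 }
  map_act := labelHom_act 𝓡
  bd_map := bd_labelHom 𝓡

end Isomorphism

end Squier

theorem mainTheorem1 {X : Type u} (𝓡 : Set (Squier.Word X × Squier.Word X)) :
    -- `C` is the free crossed `F(X)`-module on `(l, r) ↦ l⁻¹ r`, with basis `s ↦ (s, 1)`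
    ((∀ s : 𝓡, (Squier.presentationCrossedModule 𝓡).bd (Squier.basisElt 𝓡 s 1) =
        Squier.rhoHat s) ∧
      Squier.CrossedModule.IsFree.{u, u, w} (Squier.presentationCrossedModule 𝓡)
        (fun s : 𝓡 => Squier.basisElt 𝓡 s 1)) ∧
    -- and it is isomorphic to `r : star₁ → F(X)`, with `λ_{l,r,u}` corresponding to `(l, r, u)`
    ∃ φ : Squier.CrossedModule.Iso (Squier.squierCrossedModule 𝓡)
        (Squier.presentationCrossedModule 𝓡),
      ∀ (s : 𝓡) (u : FreeGroup X), φ.toEquiv (Squier.lam 𝓡 s u) = Squier.basisElt 𝓡 s u := by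
  refine ⟨⟨fun s => ?_, Squier.freeCrossedModule_isFree _⟩,
    Squier.labelIso 𝓡, Squier.labelHom_lam 𝓡⟩
  exact (Squier.FreeCM.bd_gen _ s 1).trans (by simp)
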